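/- A two-level design with $N$ runs and $m$ factors is an $N\times m$ matrix $D=(d_{ij})$ with entries $\pm1$ (repeated rows are allowed). For a set $s$ of columns put $\rho(s;D)=\frac1N\bigl|\sum_{i=1}^N\prod_{j\in s}d_{ij}\bigr|$ and, for $k\ge 1$, $A_k(D)=\sum_{|s|=k}\rho(s;D)^2$. $D$ has generalized minimum aberration among all $N\times m$ designs if for no $N\times m$ two-level design $E$ the first component in which $(A_1(E),\dots,A_m(E))$ and $(A_1(D),\dots,A_m(D))$ differ is smaller for $E$. The projectivity of $D$ is the largest $p\le m$ such that every choice of $p$ columns of $D$ contains all $2^p$ level combinations among its rows. For $v\in\mathbb Z_4^n$ let $f_z$ be the number of components of $v$ equal to $z$, and let $D_v$ be the $2^{2n}\times(2n+2)$ two-level design whose runs are the images of $uG$, $u\in\mathbb Z_4^n$, $G=(v,I_n)$, under the Gray map $0\mapsto(1,1)$, $1\mapsto(1,-1)$, $2\mapsto(-1,-1)$, $3\mapsto(-1,1)$ applied to every coordinate. A column of $D_v$ is associated with $v$ if it comes from the column $v$ of $G$, and with the number $z$ if it comes from the $i$-th column of $I_n$ and $v_i=z$. A half-fraction of $D_v$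 with branching column $c$ is the $2^{2n-1}\times(2n+1)$ design obtained by keeping the runs where $c$ has one fixed symbol ($1$ or $-1$) and deleting $c$. Theorem. (a) Let $k\ge1$. If $n=3k-1$, $f_1+f_3=2k-1$ and $f_2=k$, then $D_v$ has generalized minimum aberration among all $2^{2n}\times(2n+2)$ two-level designs, with $A_{4k}=3$ and all other $A_i=0$ ($i\ge1$); every half-fraction of $D_v$ whose branching column is associated with the number $2$ has generalized minimum aberration among all $2^{2n-1}\times(2n+1)$ two-level designs, with $A_{4k-1}=2$, $A_{4k}=1$ and all other $A_i=0$. If $n=3k$, $f_1+f_3=2k$ and $f_2=k$, then the same holds for $D_v$, with $A_{4k+1}=2$, $A_{4k+2}=1$ and all other $A_i=0$, and for every half-fraction whose branching column is associated with the number $1$ or $3$ or with $v$, with $A_{4k}=1$, $A_{4k+1}=2$ and all other $A_i=0$. If $n=3k+1$, $f_1+f_3=2k$ and $f_2=k+1$, then the same holds for $D_v$, with $A_{4k+2}=1$, $A_{4k+3}=2$ and all other $A_i=0$, and for every half-fraction whose branching column is associated with the number $2$, with $A_{4k+2}=3$ and all other $A_i=0$. (b) Suppose that $f_1+f_3=n-1$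 and $f_2=1$, or that $f_1+f_3=n$ and $f_2=0$. If $n\ge1$, then $D_v$ has projectivity $2n-1$, and no $2^{2n}\times(2n+2)$ two-level design has larger projectivity. If $n\ge2$, then every half-fraction of $D_v$ (for any branching column) has projectivity $2n-2$, and no $2^{2n-1}\times(2n+1)$ two-level design has larger projectivity. -/

import Mathlib

/-!
Two-level designs are matrices with entries in `ℤˣ = {1, -1}`; rows are runs, columns are factors.
Repeated rows and columns are allowed.
-/

namespace QuaternaryDesign

open Finset Matrix

section Criteria

variable {R F R' F' : Type*} [Fintype R] [Fintype F] [Fintype R'] [Fintype F']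

/-- The `J`-characteristic `j(s; D)` of a set `s` of columns. -/
def jChar (D : Matrix R F ℤˣ) (s : Finset F) : ℤ :=
  ∑ i, ∏ c ∈ s, (D i c : ℤ)

/-- The aliasing index `ρ(s; D) = |j(s; D)| / N`, where `N` is the number of runs. -/
def aliasingIndex (D : Matrix R F ℤˣ) (s : Finset F) : ℚ :=
  ((|jChar D s| : ℤ) : ℚ) / (Fintype.card R : ℚ)

/-- The entry `A_k(D)` of the generalized wordlength pattern. -/
def wordlength (D : Matrix R F ℤˣ) (k : ℕ) : ℚ :=
  ∑ s ∈ (univ : Finset F).powersetCard k, aliasingIndex D s ^ 2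

/-- `E` has less aberration than `D` (two designs with the same number of factors): in the first
component where `(A_1, …, A_m)` differ, `E` has the smaller value. -/
def LessAberration (E : Matrix R' F' ℤˣ) (D : Matrix R F ℤˣ) : Prop :=
  ∃ k, 1 ≤ k ∧ k ≤ Fintype.card F ∧ wordlength E k < wordlength D k ∧
    ∀ j, 1 ≤ j → j < k → wordlength E j = wordlength D j

/-- `D` is an `N × m` two-level design with generalized minimum aberration among all `N × m`
two-level designs. -/
def HasMinimumAberration (N m : ℕ) (D : Matrix R F ℤˣ) : Prop :=
  Fintype.card R = N ∧ Fintype.card F = m ∧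
    ∀ E : Matrix (Fin N) (Fin m) ℤˣ, ¬ LessAberration E D

/-- Every projection of `D` onto `p` factors contains a complete `2^p` factorial design. -/
def ProjectsOntoFactorials (D : Matrix R F ℤˣ) (p : ℕ) : Prop :=
  ∀ s : Finset F, s.card = p → ∀ x : F → ℤˣ, ∃ i : R, ∀ c ∈ s, D i c = x c

open Classical in
/-- The projectivity of `D`: the largest `p`, at most the number of factors, such that every
`p`-factor projection contains a complete `2^p` factorial design. -/
noncomputable def projectivity (D : Matrix R F ℤˣ) : ℕ :=
  Nat.findGreatest (ProjectsOntoFactorials D) (Fintype.card F)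

/-- `D` is an `N × m` two-level design of projectivity `p`, and no `N × m` two-level design has
larger projectivity. -/
def HasMaximumProjectivity (N m p : ℕ) (D : Matrix R F ℤˣ) : Prop :=
  Fintype.card R = N ∧ Fintype.card F = m ∧ projectivity D = p ∧
    ∀ E : Matrix (Fin N) (Fin m) ℤˣ, projectivity E ≤ p

end Criteria

/-- The Gray map `0 ↦ (1, 1)`, `1 ↦ (1, -1)`, `2 ↦ (-1, -1)`, `3 ↦ (-1, 1)`. -/
def gray (x : ZMod 4) : Fin 2 → ℤˣ :=
  if x = 0 then ![1, 1] else if x = 1 then ![1, -1] else if x = 2 then ![-1, -1] else ![-1, 1]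

/-- The binary image of the quaternary code generated by the rows of `G`: one run for each
linear combination `u` of the rows, and two factors for each column of `G`. -/
def binaryImage {n : ℕ} {κ : Type*} (G : Matrix (Fin n) κ (ZMod 4)) :
    Matrix (Fin n → ZMod 4) (κ × Fin 2) ℤˣ :=
  fun u c => gray ((u ᵥ* G) c.1) c.2

/-- The generator matrix `(v, I_n)`. -/
def generator {n : ℕ} (v : Fin n → ZMod 4) : Matrix (Fin n) (Unit ⊕ Fin n) (ZMod 4) :=
  Matrix.fromCols (Matrix.replicateCol Unit v) 1

/-- The two-level design generated by `G = (v, I_n)`. -/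
def design {n : ℕ} (v : Fin n → ZMod 4) :
    Matrix (Fin n → ZMod 4) ((Unit ⊕ Fin n) × Fin 2) ℤˣ :=
  binaryImage (generator v)

/-- `freq v z` is the number of components of `v` that are equal to `z`. -/
def freq {n : ℕ} (v : Fin n → ZMod 4) (z : ZMod 4) : ℕ :=
  (univ.filter fun i => v i = z).card

/-- The column `c` of `design v` comes from the `i`-th identity column, for some `i` with
`v i = z`. -/
def AssociatedWithNumber {n : ℕ} (v : Fin n → ZMod 4) (z : ZMod 4)
    (c : (Unit ⊕ Fin n) × Fin 2) : Prop :=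
  ∃ i, c.1 = Sum.inr i ∧ v i = z

/-- The column `c` of `design v` is one of the two that come from the column `v`. -/
def AssociatedWithVector {n : ℕ} (c : (Unit ⊕ Fin n) × Fin 2) : Prop :=
  c.1 = Sum.inl ()

/-- The half-fraction of `D` with branching column `c` and symbol `ε`: keep the runs where `c`
has the symbol `ε`, and delete `c`. -/
def halfFraction {R F : Type*} (D : Matrix R F ℤˣ) (c : F) (ε : ℤˣ) :
    Matrix {i : R // D i c = ε} {j : F // j ≠ c} ℤˣ :=
  fun i j => D i j

end QuaternaryDesign

open QuaternaryDesign

/-! Call ρ(s)² the weight of the word s. Both designs and half-fractions are quarter fractions, 4N =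
2^m, and this gives two inequalities for every such design. Parseval gives ∑ A_k ≥ 4 (k ≥ 0), with
equality for distinct runs, and the first Krawtchouk polynomial gives ∑ (m - 2k) A_k ≥ 0. Together
they bound ∑_{k<t} (t - k) A_k from below (`le_sum_mul_wordlength`), so a pattern concentrated on
two consecutive lengths with total word length 2m cannot be improved
(`hasMinimumAberration_of_wordlength`).

For D_v the only possible words are ∅, `oddWord v` and words with exactly one column from v. The
mixed words share one length, and Parseval fixes their total weight at 2, so no mixed
J-characteristic has to be evaluated (`wordlength_design`). A half-fraction shortens the words
through the branching column by one and keeps their weights (`wordlength_halfFraction`).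

For projectivity, D_v is the Gray image of a single parity check over Z_4 with coefficients (-1, v).
If no coefficient is 0 and at most one is 2, any three binary columns leave enough freedom to
satisfy the check. Conversely, projectivity m - 2 would require an impossible binary code
(`not_projectsOntoFactorials`). -/

namespace QuaternaryDesign

open Finset Matrix

/-! ### Linear programming bounds on the wordlength pattern -/

section Bounds

variable {R F : Type*} [Fintype R]

lemma jChar_sq (D : Matrix R F ℤˣ) (s : Finset F) :
    jChar D s ^ 2 = ∑ i, ∑ i', ∏ c ∈ s, ((D i c : ℤ) * (D i' c : ℤ)) := by
  simp only [jChar, sq, sum_mul_sum, prod_mul_distrib]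

lemma aliasingIndex_sq (D : Matrix R F ℤˣ) (s : Finset F) :
    aliasingIndex D s ^ 2 = (jChar D s : ℚ) ^ 2 / (Fintype.card R : ℚ) ^ 2 := by
  rw [aliasingIndex, div_pow]
  push_cast
  rw [sq_abs]

lemma aliasingIndex_empty [Nonempty R] (D : Matrix R F ℤˣ) : aliasingIndex D ∅ = 1 := by
  have : (Fintype.card R : ℚ) ≠ 0 := by exact_mod_cast Fintype.card_ne_zero
  simp [aliasingIndex, jChar, this]

variable [Fintype F]

lemma sum_mul_jChar_sq (D : Matrix R F ℤˣ) (g : Finset F → ℤ) :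
    ∑ s, g s * jChar D s ^ 2 =
      ∑ i, ∑ i', ∑ s, g s * ∏ c ∈ s, ((D i c : ℤ) * (D i' c : ℤ)) := by
  simp only [jChar_sq, mul_sum]
  rw [sum_comm]
  exact sum_congr rfl fun i _ => sum_comm

lemma units_mul_eq_one_or (a b : ℤˣ) : (a : ℤ) * b = 1 ∨ (a : ℤ) * b = -1 := by
  rcases Int.units_eq_one_or a with rfl | rfl <;> rcases Int.units_eq_one_or b with rfl | rfl <;>
    simp

lemma sum_prod_units (x y : F → ℤˣ) :
    ∑ s : Finset F, ∏ c ∈ s, ((x c : ℤ) * (y c : ℤ)) =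
      ∏ c, (1 + (x c : ℤ) * (y c : ℤ)) := by
  classical
  rw [prod_one_add, powerset_univ]

lemma sum_prod_units_nonneg (x y : F → ℤˣ) :
    0 ≤ ∑ s : Finset F, ∏ c ∈ s, ((x c : ℤ) * (y c : ℤ)) := by
  rw [sum_prod_units]
  refine prod_nonneg fun c _ => ?_
  rcases units_mul_eq_one_or (x c) (y c) with h | h <;> simp [h]

lemma sum_prod_units_self (x : F → ℤˣ) :
    ∑ s : Finset F, ∏ c ∈ s, ((x c : ℤ) * (x c : ℤ)) = 2 ^ Fintype.card F := by
  rw [sum_prod_units]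
  simp

lemma sum_prod_units_of_ne {x y : F → ℤˣ} (h : x ≠ y) :
    ∑ s : Finset F, ∏ c ∈ s, ((x c : ℤ) * (y c : ℤ)) = 0 := by
  rw [sum_prod_units]
  obtain ⟨c, hc⟩ := Function.ne_iff.mp h
  refine prod_eq_zero (mem_univ c) ?_
  revert hc
  rcases Int.units_eq_one_or (x c) with h | h <;>
    rcases Int.units_eq_one_or (y c) with h' | h' <;> simp [h, h']

/-- Summed over all s, a pair of runs x, y contributes ∏ (1 + x_c y_c), which is 2^m if x = y and 0
otherwise. The N diagonal pairs give the bound; repeated runs only add to it. -/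
lemma le_sum_jChar_sq (D : Matrix R F ℤˣ) :
    (Fintype.card R : ℤ) * 2 ^ Fintype.card F ≤ ∑ s, jChar D s ^ 2 := by
  have h := sum_mul_jChar_sq D fun _ => 1
  simp only [one_mul] at h
  rw [h, ← nsmul_eq_mul, ← card_univ, ← sum_const]
  refine sum_le_sum fun i _ => ?_
  rw [← sum_prod_units_self (D i)]
  exact single_le_sum (f := fun i' => ∑ s : Finset F, ∏ c ∈ s, ((D i c : ℤ) * (D i' c : ℤ)))
    (fun i' _ => sum_prod_units_nonneg (D i) (D i')) (mem_univ i)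

lemma sum_jChar_sq_of_injective {D : Matrix R F ℤˣ} (hD : Function.Injective D) :
    ∑ s, jChar D s ^ 2 = (Fintype.card R : ℤ) * 2 ^ Fintype.card F := by
  have h := sum_mul_jChar_sq D fun _ => 1
  simp only [one_mul] at h
  rw [h, ← nsmul_eq_mul, ← card_univ, ← sum_const]
  refine sum_congr rfl fun i _ => ?_
  rw [← sum_prod_units_self (D i)]
  exact sum_eq_single_of_mem i (mem_univ i) fun i' _ hi =>
    sum_prod_units_of_ne fun e => hi (hD e.symm)

/-- The factor m - 2|s| is the sum over d of (-1)^[d ∈ s]. Each d thus contributes the product ∏ (1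
± x_c y_c) with the sign reversed at c = d, and all its factors are 0 or 2. -/
lemma sum_sub_card_mul_prod_nonneg (x y : F → ℤˣ) :
    0 ≤ ∑ s : Finset F, ((Fintype.card F : ℤ) - 2 * s.card) *
      ∏ c ∈ s, ((x c : ℤ) * (y c : ℤ)) := by
  classical
  have key (s : Finset F) : ((Fintype.card F : ℤ) - 2 * s.card) *
      ∏ c ∈ s, ((x c : ℤ) * (y c : ℤ)) =
      ∑ d, ∏ c ∈ s, (((x c : ℤ) * (y c : ℤ)) * if c = d then -1 else 1) := by
    simp only [prod_mul_distrib, ← mul_sum]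
    rw [mul_comm]
    congr 1
    have (d : F) : ∏ c ∈ s, (if c = d then (-1 : ℤ) else 1) =
        1 - 2 * if d ∈ s then 1 else 0 := by
      rw [prod_ite_eq' s d]
      split_ifs <;> norm_num
    simp [this, mul_comm]
  simp only [key]
  rw [sum_comm]
  refine sum_nonneg fun d _ => ?_
  rw [← powerset_univ, ← prod_one_add]
  refine prod_nonneg fun c _ => ?_
  rcases units_mul_eq_one_or (x c) (y c) with h | h <;> split_ifs <;> simp [h]

lemma sum_sub_card_mul_jChar_sq_nonneg (D : Matrix R F ℤˣ) :
    0 ≤ ∑ s, ((Fintype.card F : ℤ) - 2 * s.card) * jChar D s ^ 2 := by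
  rw [sum_mul_jChar_sq]
  exact sum_nonneg fun i _ => sum_nonneg fun i' _ => sum_sub_card_mul_prod_nonneg _ _

lemma wordlength_nonneg (D : Matrix R F ℤˣ) (k : ℕ) : 0 ≤ wordlength D k :=
  sum_nonneg fun _ _ => sq_nonneg _

lemma wordlength_eq_sum_ite (D : Matrix R F ℤˣ) (k : ℕ) :
    wordlength D k = ∑ s, (if s.card = k then 1 else 0) * aliasingIndex D s ^ 2 := by
  simp only [ite_mul, one_mul, zero_mul, ← sum_filter]
  refine sum_congr ?_ fun _ _ => rfl
  ext s
  simp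

lemma sum_mul_wordlength (D : Matrix R F ℤˣ) (g : ℕ → ℚ) :
    ∑ k ∈ range (Fintype.card F + 1), g k * wordlength D k =
      ∑ s : Finset F, g s.card * aliasingIndex D s ^ 2 := by
  simp only [wordlength_eq_sum_ite, mul_sum]
  rw [sum_comm]
  refine sum_congr rfl fun s _ => ?_
  rw [sum_eq_single_of_mem s.card (mem_range.mpr (Nat.lt_succ_of_le (card_le_univ s)))]
  · simp
  · intro k _ hk
    simp [hk.symm]

lemma wordlength_zero [Nonempty R] (D : Matrix R F ℤˣ) : wordlength D 0 = 1 := by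
  simp [wordlength, aliasingIndex_empty]

/-- The total weight of the words of a quarter fraction, including the empty one. -/
lemma four_le_sum_wordlength {D : Matrix R F ℤˣ}
    (hN : 4 * Fintype.card R = 2 ^ Fintype.card F) :
    4 ≤ ∑ k ∈ range (Fintype.card F + 1), wordlength D k := by
  have h := sum_mul_wordlength D fun _ => 1
  simp only [one_mul] at h
  have hpos : (0 : ℚ) < (Fintype.card R : ℚ) := by
    have : 0 < 2 ^ Fintype.card F := by positivity
    exact_mod_cast (by lia : 0 < Fintype.card R)
  rw [h]
  simp only [aliasingIndex_sq]
  rw [← sum_div, le_div_iff₀ (by positivity)]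
  have h1 : ((Fintype.card R : ℤ) * 2 ^ Fintype.card F : ℚ) ≤ ∑ s, (jChar D s : ℚ) ^ 2 := by
    exact_mod_cast le_sum_jChar_sq D
  have h2 : (4 * Fintype.card R : ℚ) = 2 ^ Fintype.card F := by exact_mod_cast hN
  push_cast at h1
  rw [← h2] at h1
  linarith

lemma sum_aliasingIndex_sq_of_injective {D : Matrix R F ℤˣ} (hD : Function.Injective D)
    (hN : 4 * Fintype.card R = 2 ^ Fintype.card F) :
    ∑ s, aliasingIndex D s ^ 2 = 4 := by
  have hpos : (0 : ℚ) < (Fintype.card R : ℚ) := by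
    have : 0 < 2 ^ Fintype.card F := by positivity
    exact_mod_cast (by lia : 0 < Fintype.card R)
  simp only [aliasingIndex_sq]
  rw [← sum_div, div_eq_iff (by positivity)]
  have h1 : ∑ s, (jChar D s : ℚ) ^ 2 = ((Fintype.card R : ℤ) * 2 ^ Fintype.card F : ℚ) := by
    exact_mod_cast sum_jChar_sq_of_injective hD
  have h2 : (4 * Fintype.card R : ℚ) = 2 ^ Fintype.card F := by exact_mod_cast hN
  rw [h1, ← h2]
  push_cast
  ring

lemma sum_sub_mul_wordlength_nonneg (D : Matrix R F ℤˣ) :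
    0 ≤ ∑ k ∈ range (Fintype.card F + 1), ((Fintype.card F : ℚ) - 2 * k) * wordlength D k := by
  rw [sum_mul_wordlength D fun k => (Fintype.card F : ℚ) - 2 * k]
  simp only [aliasingIndex_sq, ← mul_div_assoc]
  rw [← sum_div]
  refine div_nonneg ?_ (by positivity)
  exact_mod_cast sum_sub_card_mul_jChar_sq_nonneg D

/-- The linear programming bound for quarter fractions. -/
lemma le_sum_mul_wordlength {D : Matrix R F ℤˣ}
    (hN : 4 * Fintype.card R = 2 ^ Fintype.card F) {r : ℕ} (hr : Fintype.card F ≤ 2 * r) :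
    (4 * r - 2 * Fintype.card F : ℚ) ≤
      ∑ k ∈ range (Fintype.card F + 1), ((r : ℚ) - k) * wordlength D k := by
  have h1 := four_le_sum_wordlength (D := D) hN
  have h2 := sum_sub_mul_wordlength_nonneg D
  -- The combination 2(r - k) = (2r - m) + (m - 2k); the first coefficient is nonnegative since m ≤
  -- 2r.
  have h3 : 2 * ∑ k ∈ range (Fintype.card F + 1), ((r : ℚ) - k) * wordlength D k =
      (2 * r - Fintype.card F) * ∑ k ∈ range (Fintype.card F + 1), wordlength D k +
        ∑ k ∈ range (Fintype.card F + 1), ((Fintype.card F : ℚ) - 2 * k) * wordlength D k := by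
    simp only [mul_sum, ← sum_add_distrib]
    exact sum_congr rfl fun k _ => by ring
  have hr' : (Fintype.card F : ℚ) ≤ 2 * r := by exact_mod_cast hr
  have h4 := mul_le_mul_of_nonneg_left h1 (sub_nonneg.mpr hr')
  linarith

lemma sum_mul_wordlength_le {D : Matrix R F ℤˣ} (r m : ℕ) :
    ∑ k ∈ range (m + 1), ((r : ℚ) - k) * wordlength D k ≤
      ∑ k ∈ range r, ((r : ℚ) - k) * wordlength D k := by
  rw [← sum_filter_add_sum_filter_not (range (m + 1)) (· < r)]
  have h1 : ∑ k ∈ range (m + 1) with ¬ k < r, ((r : ℚ) - k) * wordlength D k ≤ 0 := by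
    refine sum_nonpos fun k hk => mul_nonpos_of_nonpos_of_nonneg ?_ (wordlength_nonneg D k)
    have : (r : ℚ) ≤ k := by exact_mod_cast not_lt.mp (mem_filter.mp hk).2
    linarith
  have h2 : ∑ k ∈ range (m + 1) with k < r, ((r : ℚ) - k) * wordlength D k ≤
      ∑ k ∈ range r, ((r : ℚ) - k) * wordlength D k := by
    refine sum_le_sum_of_subset_of_nonneg (fun k hk => mem_range.mpr (mem_filter.mp hk).2)
      fun k hk _ => mul_nonneg ?_ (wordlength_nonneg D k)
    have : (k : ℚ) ≤ r := by exact_mod_cast (mem_range.mp hk).le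
    linarith
  linarith

lemma sum_range_mul_of_eq_zero {A f : ℕ → ℚ} (r : ℕ) (hr : 1 ≤ r)
    (hA : ∀ k, 1 ≤ k → k < r → A k = 0) :
    ∑ k ∈ range r, f k * A k = f 0 * A 0 := by
  refine sum_eq_single_of_mem 0 (mem_range.mpr hr) fun k hk hk0 => ?_
  rw [hA k (Nat.one_le_iff_ne_zero.mpr hk0) (mem_range.mp hk), mul_zero]

/-- A quarter fraction whose words have lengths `r` (with total weight `a`) and `r + 1` (with
total weight `3 - a`) and whose total word length is twice the number of factors has generalized
minimum aberration. -/
lemma hasMinimumAberration_of_wordlength {D : Matrix R F ℤˣ} {N m : ℕ}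
    (hR : Fintype.card R = N) (hF : Fintype.card F = m) (hN : 4 * N = 2 ^ m)
    {r a : ℕ} (hr : 1 ≤ r) (hrm : m ≤ 2 * r) (ha : 3 * r + 3 = 2 * m + a)
    (hD : ∀ i, 1 ≤ i →
      wordlength D i = if i = r then (a : ℚ) else if i = r + 1 then 3 - a else 0) :
    HasMinimumAberration N m D := by
  refine ⟨hR, hF, fun E ⟨k, hk1, _, hlt, heq⟩ => ?_⟩
  have hNpos : 0 < N := by
    have : 0 < 2 ^ m := by positivity
    lia
  have : Nonempty (Fin N) := ⟨0, hNpos⟩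
  have hN' : 4 * Fintype.card (Fin N) = 2 ^ Fintype.card (Fin m) := by simpa using hN
  have haq : (3 * r + 3 : ℚ) = 2 * m + a := by exact_mod_cast ha
  have hE0 := wordlength_zero E
  have hE (j : ℕ) (h1 : 1 ≤ j) (hj : j < k) (hjr : j < r) : wordlength E j = 0 := by
    rw [heq j h1 hj, hD j h1, if_neg hjr.ne, if_neg (by lia)]
  have hlow (t : ℕ) (h1 : 1 ≤ t) (ht : m ≤ 2 * t) :
      (4 * t - 2 * m : ℚ) ≤ ∑ k ∈ range t, ((t : ℚ) - k) * wordlength E k := by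
    refine le_trans ?_ (sum_mul_wordlength_le t m)
    simpa using le_sum_mul_wordlength hN' (r := t) (by simpa using ht)
  rw [hD k hk1] at hlt
  split_ifs at hlt with h h
  · subst h
    -- At t = r + 1 only A_0 = 1 and A_r survive, and the bound reads A_r ≥ 3r + 3 - 2m = a.
    have := hlow (k + 1) (by lia) (by lia)
    rw [sum_range_succ, sum_range_mul_of_eq_zero k hk1 fun j h1 hj => hE j h1 hj hj, hE0] at this
    push_cast at this
    linarith
  · subst h
    have hEr := heq r hr (Nat.lt_succ_self r)
    rw [hD r hr, if_pos rfl] at hEr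
    -- At t = r + 2, with A_r = a, the bound reads A_{r+1} ≥ 3 - a.
    have := hlow (r + 2) (by lia) (by lia)
    rw [sum_range_succ, sum_range_succ,
      sum_range_mul_of_eq_zero r hr fun j h1 hj => hE j h1 (by lia) hj, hE0, hEr] at this
    push_cast at this
    linarith
  · exact absurd hlt (not_lt.mpr (wordlength_nonneg E k))

end Bounds

/-! ### Upper bound on the projectivity of quarter fractions -/

section Projectivity

variable {R F : Type*}

lemma ProjectsOntoFactorials.mono {D : Matrix R F ℤˣ} {p q : ℕ} [Fintype F]
    (h : ProjectsOntoFactorials D q) (hpq : p ≤ q) (hq : q ≤ Fintype.card F) :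
    ProjectsOntoFactorials D p := by
  intro s hs x
  obtain ⟨t, hst, ht⟩ := exists_superset_card_eq (s := s) (hs ▸ hpq) hq
  obtain ⟨i, hi⟩ := h t ht x
  exact ⟨i, fun c hc => hi c (hst hc)⟩

lemma units_eq_of_ne_neg {a b : ℤˣ} : a ≠ -b → a = b := by
  revert a b
  decide

/-- In a quarter fraction that projects onto all the `2 ^ (m - 2)` factorials, two runs that agree
on `m - 2` factors are equal. -/
lemma eq_of_projectsOntoFactorials [Fintype R] [Fintype F] {D : Matrix R F ℤˣ}
    {p : ℕ} (hp : Fintype.card R = 2 ^ p) (h : ProjectsOntoFactorials D p)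
    {s : Finset F} (hs : s.card = p) {i j : R} (hij : ∀ c ∈ s, D i c = D j c) : i = j := by
  classical
  let f : R → (s → ℤˣ) := fun i c => D i c
  have hf : Function.Surjective f := by
    intro x
    obtain ⟨i, hi⟩ := h s hs fun c => if hc : c ∈ s then x ⟨c, hc⟩ else 1
    refine ⟨i, funext fun c => ?_⟩
    simpa using hi c c.2
  have hcard : Fintype.card R = Fintype.card (s → ℤˣ) := by
    simp [hp, hs]
  exact ((Fintype.bijective_iff_surjective_and_card f).mpr ⟨hf, hcard⟩).1
    (funext fun c => hij c c.2)

/-- No quarter fraction with `m ≥ 4` factors projects onto all `2 ^ (m - 2)` factorials: the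
runs would form a code of length `m` and minimum distance `3` in which any word that differs
from a run in one place would have to be covered in too many ways. -/
lemma not_projectsOntoFactorials [Fintype R] [Fintype F] (D : Matrix R F ℤˣ)
    {p : ℕ} (hp : Fintype.card R = 2 ^ p) (hF : Fintype.card F = p + 2) (h2 : 2 ≤ p) :
    ¬ ProjectsOntoFactorials D p := by
  classical
  intro h
  have hne : Nonempty R := by
    rw [← Fintype.card_pos_iff, hp]
    positivity
  obtain ⟨i₀⟩ := hne
  obtain ⟨e⟩ : Nonempty (Fin 4 ↪ F) := Function.Embedding.nonempty_of_card_le (by simp; lia)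
  have hdist : ∀ i j : R, ∀ a b : F, (∀ c, c ≠ a → c ≠ b → D i c = D j c) → i = j := by
    intro i j a b hij
    obtain ⟨s, hs, hsc⟩ := exists_subset_card_eq (s := ({a, b} : Finset F)ᶜ) (n := p) (by
      rw [card_compl, hF]
      have := card_le_two (a := a) (b := b)
      lia)
    refine eq_of_projectsOntoFactorials hp h hsc fun c hc => ?_
    have := hs hc
    simp only [mem_compl, mem_insert, mem_singleton, not_or] at this
    exact hij c this.1 this.2
  have hex : ∀ a b : F, a ≠ b → a ≠ e 0 → b ≠ e 0 → ∃ i, D i (e 0) = - D i₀ (e 0) ∧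
      D i a = - D i₀ a ∧ D i b = - D i₀ b ∧
      ∀ c, c ≠ e 0 → c ≠ a → c ≠ b → D i c = D i₀ c := by
    intro a b hab ha hb
    -- The values at `a` and `b` are left open. If one of them agreed with `i₀`, the two runs would
    -- differ in at most two places and hence coincide, against `e 0`.
    obtain ⟨i, hi⟩ := h ({a, b} : Finset F)ᶜ (by rw [card_compl, hF, card_pair hab]; lia)
      (fun c => if c = e 0 then - D i₀ c else D i₀ c)
    have h0 : D i (e 0) = - D i₀ (e 0) := by
      have := hi (e 0) (by simp [ha.symm, hb.symm])
      simpa using this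
    have hrest : ∀ c, c ≠ e 0 → c ≠ a → c ≠ b → D i c = D i₀ c := by
      intro c h0 h1 h2
      have := hi c (by simp [h1, h2])
      simpa [h0] using this
    have hne : D i (e 0) ≠ D i₀ (e 0) := by
      rw [h0]
      exact neg_units_ne_self _
    refine ⟨i, h0, ?_, ?_, hrest⟩
    · by_contra hcon
      have hcon' : D i a = D i₀ a := units_eq_of_ne_neg hcon
      have := hdist i i₀ (e 0) b fun c h1 h2 => by
        by_cases hca : c = a
        · rw [hca, hcon']
        · exact hrest c h1 hca h2
      exact hne (by rw [this])
    · by_contra hcon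
      have hcon' : D i b = D i₀ b := units_eq_of_ne_neg hcon
      have := hdist i i₀ (e 0) a fun c h1 h2 => by
        by_cases hcb : c = b
        · rw [hcb, hcon']
        · exact hrest c h1 h2 hcb
      exact hne (by rw [this])
  have hinj {x y : Fin 4} (hxy : x ≠ y) : e x ≠ e y := fun h => hxy (e.injective h)
  obtain ⟨i, hi0, hi1, hi2, hi⟩ := hex (e 1) (e 2) (hinj (by decide)) (hinj (by decide))
    (hinj (by decide))
  obtain ⟨j, hj0, hj1, hj3, hj⟩ := hex (e 1) (e 3) (hinj (by decide)) (hinj (by decide))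
    (hinj (by decide))
  -- The runs differ from `i₀` exactly in positions 0, 1, 2 and 0, 1, 3 of `e`, hence from each
  -- other only in positions 2 and 3.
  have hij : i = j := hdist i j (e 2) (e 3) fun c h2 h3 => by
    by_cases h0 : c = e 0
    · rw [h0, hi0, hj0]
    by_cases h1 : c = e 1
    · rw [h1, hi1, hj1]
    rw [hi c h0 h1 h2, hj c h0 h1 h3]
  have hj2 := hj (e 2) (hinj (by decide)) (hinj (by decide)) (hinj (by decide))
  rw [hij, hj2] at hi2
  exact neg_units_ne_self _ hi2.symm

lemma projectivity_lt [Fintype R] [Fintype F] (D : Matrix R F ℤˣ)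
    {p : ℕ} (hp : Fintype.card R = 2 ^ p) (hF : Fintype.card F = p + 2) (h2 : 2 ≤ p) :
    projectivity D < p := by
  classical
  by_contra! hle
  unfold projectivity at hle
  have hspec : ProjectsOntoFactorials D _ :=
    Nat.findGreatest_of_ne_zero (P := ProjectsOntoFactorials D) (n := Fintype.card F) rfl (by lia)
  exact not_projectsOntoFactorials D hp hF h2 (hspec.mono hle (Nat.findGreatest_le _))

lemma hasMaximumProjectivity_of_projectsOntoFactorials [Fintype R] [Fintype F]
    {D : Matrix R F ℤˣ} {N m p : ℕ} (hR : Fintype.card R = N) (hF : Fintype.card F = m)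
    (hN : N = 2 ^ (p + 1)) (hm : m = p + 3) (h1 : 1 ≤ p) (h : ProjectsOntoFactorials D p) :
    HasMaximumProjectivity N m p D := by
  classical
  subst hN hm
  refine ⟨hR, hF, le_antisymm ?_ ?_, fun E => ?_⟩
  · exact Nat.lt_succ_iff.mp (projectivity_lt D hR hF (by lia))
  · exact Nat.le_findGreatest (by lia) h
  · exact Nat.lt_succ_iff.mp (projectivity_lt E (by simp) (by simp) (by lia))

/-- Fixing a factor costs one unit of projectivity. -/
lemma ProjectsOntoFactorials.halfFraction [DecidableEq F] {D : Matrix R F ℤˣ} {p : ℕ}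
    (h : ProjectsOntoFactorials D (p + 1)) (c : F) (ε : ℤˣ) :
    ProjectsOntoFactorials (halfFraction D c ε) p := by
  intro s hs x
  obtain ⟨i, hi⟩ := h (insert c (s.map (Function.Embedding.subtype _)))
    (by rw [card_insert_of_notMem (by simp), card_map, hs])
    (fun d => if hd : d = c then ε else x ⟨d, hd⟩)
  refine ⟨⟨i, by simpa using hi c (mem_insert_self _ _)⟩, fun d hd => ?_⟩
  have := hi d (mem_insert_of_mem (mem_map_of_mem (Function.Embedding.subtype _) hd))
  simp only [d.2, dite_false] at this
  exact this

end Projectivity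

/-! ### The words of D_v -/

section Design

/-- The product of those of the two Gray columns that are selected by `a` and `b`. -/
def grayWord (a b : Bool) (x : ZMod 4) : ℤˣ :=
  (if a then gray x 0 else 1) * (if b then gray x 1 else 1)

lemma grayWord_injective {x y : ZMod 4} (h0 : gray x 0 = gray y 0) (h1 : gray x 1 = gray y 1) :
    x = y := by
  revert x y
  decide

lemma gray_neg (x : ZMod 4) (b : Fin 2) : gray (-x) b = gray x (Fin.rev b) := by
  revert x b
  decide

lemma exists_gray_eq (y : Fin 2 → ℤˣ) : ∃ x, gray x = y := by
  revert y
  decide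

/-- The product of both Gray columns is the character x ↦ (-1)^x of Z_4. -/
lemma grayWord_true_add (x y : ZMod 4) :
    grayWord true true (x + y) = grayWord true true x * grayWord true true y := by
  revert x y
  decide

lemma grayWord_true_mul (x z : ZMod 4) :
    grayWord true true (x * z) = if z = 1 ∨ z = 3 then grayWord true true x else 1 := by
  revert x z
  decide

/-- The selections of Gray columns that are compatible with each other for the column `v` (`A`,
`B`) and for an identity column (`a`, `b`) associated with the number `z`. -/
def Compatible (A B a b : Bool) (z : ZMod 4) : Prop :=
  if A = B then a = (A && (z = 1 ∨ z = 3)) ∧ b = (A && (z = 1 ∨ z = 3))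
  else if z = 0 then a = false ∧ b = false
  else if z = 2 then a = true ∧ b = true
  else a ≠ b

instance (A B a b : Bool) (z : ZMod 4) : Decidable (Compatible A B a b z) := by
  unfold Compatible
  infer_instance

/-- A single Gray column changes sign under a shift by 2 and is not affected by 0; the product of
both changes sign under odd shifts only. In each incompatible case t = 1 or t = 2 reverses exactly
one of the two factors. -/
lemma exists_shift_of_not_compatible (A B a b : Bool) (z : ZMod 4) (h : ¬ Compatible A B a b z) :
    ∃ t, ∀ x y, grayWord A B (x + t * z) * grayWord a b (y + t) =
      - (grayWord A B x * grayWord a b y) := by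
  revert z
  cases A <;> cases B <;> cases a <;> cases b <;> decide

variable {n : ℕ} {v : Fin n → ZMod 4}

lemma vecMul_generator_inl (u : Fin n → ZMod 4) (x : Unit) :
    (u ᵥ* generator v) (Sum.inl x) = ∑ i, u i * v i := by
  simp [generator, vecMul, dotProduct, fromCols, replicateCol]

lemma vecMul_generator_inr (u : Fin n → ZMod 4) (i : Fin n) :
    (u ᵥ* generator v) (Sum.inr i) = u i := by
  simp [generator, vecMul, dotProduct, fromCols, Matrix.one_apply]

lemma design_inl (u : Fin n → ZMod 4) (x : Unit) (b : Fin 2) :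
    design v u (Sum.inl x, b) = gray (∑ i, u i * v i) b := by
  rw [design, binaryImage, vecMul_generator_inl]

lemma design_inr (u : Fin n → ZMod 4) (i : Fin n) (b : Fin 2) :
    design v u (Sum.inr i, b) = gray (u i) b := by
  rw [design, binaryImage, vecMul_generator_inr]

lemma design_injective (v : Fin n → ZMod 4) : Function.Injective (design v) := by
  intro u u' h
  funext i
  have h0 := congrFun h (Sum.inr i, 0)
  have h1 := congrFun h (Sum.inr i, 1)
  rw [design_inr, design_inr] at h0 h1
  exact grayWord_injective h0 h1

lemma card_runs (n : ℕ) : Fintype.card (Fin n → ZMod 4) = 2 ^ (2 * n) := by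
  simp [pow_mul]

lemma card_factors (n : ℕ) : Fintype.card ((Unit ⊕ Fin n) × Fin 2) = 2 * n + 2 := by
  simp
  ring

lemma four_mul_card_runs (n : ℕ) :
    4 * Fintype.card (Fin n → ZMod 4) = 2 ^ Fintype.card ((Unit ⊕ Fin n) × Fin 2) := by
  rw [card_runs, card_factors]
  ring

/-- Two-level product over a set of columns, arranged by quaternary columns. -/
lemma prod_design (v u : Fin n → ZMod 4) (s : Finset ((Unit ⊕ Fin n) × Fin 2)) :
    ∏ c ∈ s, design v u c =
      grayWord ((Sum.inl (), 0) ∈ s) ((Sum.inl (), 1) ∈ s) (∑ i, u i * v i) *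
        ∏ i, grayWord ((Sum.inr i, 0) ∈ s) ((Sum.inr i, 1) ∈ s) (u i) := by
  have : ∏ c ∈ s, design v u c = ∏ c, if c ∈ s then design v u c else 1 := by
    rw [prod_ite_mem, univ_inter]
  rw [this, Fintype.prod_prod_type, Fintype.prod_sum_type]
  simp [Fin.prod_univ_two, grayWord, design_inl, design_inr]

lemma card_eq_sum_blocks (s : Finset ((Unit ⊕ Fin n) × Fin 2)) :
    s.card = (if (Sum.inl (), 0) ∈ s then 1 else 0) + (if (Sum.inl (), 1) ∈ s then 1 else 0) +
      ∑ i : Fin n, ((if (Sum.inr i, 0) ∈ s then 1 else 0) +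
        (if (Sum.inr i, 1) ∈ s then 1 else 0)) := by
  have : s.card = ∑ c, if c ∈ s then 1 else 0 := by simp
  rw [this, Fintype.sum_prod_type, Fintype.sum_sum_type]
  simp only [univ_unique, sum_singleton, Fin.sum_univ_two]

/-- The `J`-characteristic as a sum of signs. -/
lemma jChar_eq_sum_units {R F : Type*} [Fintype R] (D : Matrix R F ℤˣ) (s : Finset F) :
    jChar D s = ∑ i, ((∏ c ∈ s, D i c : ℤˣ) : ℤ) := by
  simp [jChar]

lemma jChar_eq_zero_of_shift {R F : Type*} [Fintype R] [AddGroup R] (D : Matrix R F ℤˣ)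
    (s : Finset F) (w : R) (h : ∀ u, ∏ c ∈ s, D (u + w) c = - ∏ c ∈ s, D u c) :
    jChar D s = 0 := by
  have h1 : jChar D s = - jChar D s := by
    rw [jChar_eq_sum_units, ← sum_neg_distrib,
      ← Equiv.sum_comp (Equiv.addRight w) fun u => ((∏ c ∈ s, D u c : ℤˣ) : ℤ)]
    refine sum_congr rfl fun u _ => ?_
    rw [Equiv.coe_addRight, h, Units.val_neg]
  lia

/-- Only words whose blocks are pairwise compatible occur. -/
lemma compatible_of_jChar_ne_zero {s : Finset ((Unit ⊕ Fin n) × Fin 2)}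
    (h : jChar (design v) s ≠ 0) (i : Fin n) :
    Compatible ((Sum.inl (), 0) ∈ s) ((Sum.inl (), 1) ∈ s) ((Sum.inr i, 0) ∈ s)
      ((Sum.inr i, 1) ∈ s) (v i) := by
  by_contra hcon
  obtain ⟨t, ht⟩ := exists_shift_of_not_compatible _ _ _ _ _ hcon
  refine h (jChar_eq_zero_of_shift _ _ (Pi.single i t) fun u => ?_)
  rw [prod_design, prod_design]
  have h1 : ∑ j, (u + Pi.single i t : Fin n → ZMod 4) j * v j = ∑ j, u j * v j + t * v i := by
    simp [add_mul, sum_add_distrib, Pi.single_apply]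
  rw [h1, ← mul_prod_erase univ _ (mem_univ i), ← mul_prod_erase univ _ (mem_univ i),
    ← mul_assoc, ← mul_assoc, Pi.add_apply, Pi.single_eq_same, ht, neg_mul]
  congr 2
  refine prod_congr rfl fun j hj => ?_
  rw [Pi.add_apply, Pi.single_eq_of_ne (ne_of_mem_erase hj), add_zero]

/-- The word that consists of the two columns from `v` and of the columns associated with odd
numbers. -/
def oddWord (v : Fin n → ZMod 4) : Finset ((Unit ⊕ Fin n) × Fin 2) :=
  univ.filter fun c => ∀ i, c.1 = Sum.inr i → v i = 1 ∨ v i = 3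

/-- The words that contain exactly one of the two columns from `v`. -/
def mixedWords (n : ℕ) : Finset (Finset ((Unit ⊕ Fin n) × Fin 2)) :=
  univ.filter fun s => ¬ ((Sum.inl (), 0) ∈ s ↔ (Sum.inl (), 1) ∈ s)

lemma inl_mem_oddWord (b : Fin 2) : (Sum.inl (), b) ∈ oddWord v := by
  simp [oddWord]

lemma inr_mem_oddWord (i : Fin n) (b : Fin 2) :
    (Sum.inr i, b) ∈ oddWord v ↔ v i = 1 ∨ v i = 3 := by
  simp [oddWord]

lemma eq_of_blocks {s t : Finset ((Unit ⊕ Fin n) × Fin 2)}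
    (hl : ∀ b, (Sum.inl (), b) ∈ s ↔ (Sum.inl (), b) ∈ t)
    (hr : ∀ i b, (Sum.inr i, b) ∈ s ↔ (Sum.inr i, b) ∈ t) : s = t := by
  ext ⟨p | i, b⟩
  exacts [hl b, hr i b]

/-- When both or neither of the columns from v are present, compatibility determines every other
block, leaving one candidate each. -/
lemma jChar_ne_zero_cases {s : Finset ((Unit ⊕ Fin n) × Fin 2)} (h : jChar (design v) s ≠ 0) :
    s = ∅ ∨ s = oddWord v ∨ s ∈ mixedWords n := by
  have hc := compatible_of_jChar_ne_zero h
  by_cases h0 : (Sum.inl (), 0) ∈ s <;> by_cases h1 : (Sum.inl (), 1) ∈ s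
  · right; left
    refine eq_of_blocks (fun b => ?_) fun i b => ?_
    · fin_cases b <;> simp [h0, h1, inl_mem_oddWord]
    · have := hc i
      rw [inr_mem_oddWord, ← decide_eq_decide]
      simp only [Compatible, h0, h1, if_true, decide_true, Bool.true_and] at this
      fin_cases b
      exacts [this.1, this.2]
  · right; right
    simp [mixedWords, h0, h1]
  · right; right
    simp [mixedWords, h0, h1]
  · left
    refine eq_of_blocks (fun b => ?_) fun i b => ?_
    · fin_cases b <;> simp [h0, h1]
    · have := hc i
      fin_cases b <;> simp_all [Compatible]

lemma freq_eq_sum (v : Fin n → ZMod 4) (z : ZMod 4) :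
    freq v z = ∑ i, if v i = z then 1 else 0 := by
  simp [freq]

lemma card_oddWord (v : Fin n → ZMod 4) :
    (oddWord v).card = 2 + 2 * (freq v 1 + freq v 3) := by
  rw [card_eq_sum_blocks, freq_eq_sum, freq_eq_sum, ← sum_add_distrib, mul_sum]
  simp only [inl_mem_oddWord, inr_mem_oddWord, if_true]
  congr 1
  refine sum_congr rfl fun i _ => ?_
  generalize v i = z
  revert z
  decide

/-- Compatibility with exactly one column from v makes a block contribute 0, 2 or 1 columns
according as v_i is 0, 2 or odd; the choice within odd blocks does not affect the length. -/
lemma card_of_mem_mixedWords {s : Finset ((Unit ⊕ Fin n) × Fin 2)} (hs : s ∈ mixedWords n)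
    (h : jChar (design v) s ≠ 0) :
    s.card = 1 + (2 * freq v 2 + (freq v 1 + freq v 3)) := by
  have hc := compatible_of_jChar_ne_zero h
  simp only [mixedWords, mem_filter, mem_univ, true_and] at hs
  rw [card_eq_sum_blocks, freq_eq_sum, freq_eq_sum, freq_eq_sum, ← sum_add_distrib, mul_sum,
    ← sum_add_distrib]
  congr 1
  · by_cases h0 : (Sum.inl (), 0) ∈ s <;> by_cases h1 : (Sum.inl (), 1) ∈ s <;> simp_all
  · refine sum_congr rfl fun i _ => ?_
    have hi := hc i
    have hAB : decide ((Sum.inl (), 0) ∈ s) ≠ decide ((Sum.inl (), 1) ∈ s) := by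
      simpa using hs
    rw [Compatible, if_neg hAB] at hi
    have key : ∀ (a b : Bool) (z : ZMod 4), (if z = 0 then a = false ∧ b = false else
        if z = 2 then a = true ∧ b = true else a ≠ b) →
        (if a then 1 else 0) + (if b then 1 else 0) =
        2 * (if z = 2 then 1 else 0) + ((if z = 1 then 1 else 0) + if z = 3 then 1 else 0) := by
      decide
    simpa using key _ _ _ hi

lemma grayWord_true_sum {ι : Type*} (t : Finset ι) (f : ι → ZMod 4) :
    grayWord true true (∑ i ∈ t, f i) = ∏ i ∈ t, grayWord true true (f i) := by
  classical
  induction t using Finset.induction_on with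
  | empty => rfl
  | insert i t hi ih => rw [sum_insert hi, prod_insert hi, grayWord_true_add, ih]

lemma jChar_oddWord (v : Fin n → ZMod 4) :
    jChar (design v) (oddWord v) = Fintype.card (Fin n → ZMod 4) := by
  rw [jChar_eq_sum_units]
  have (u : Fin n → ZMod 4) : ∏ c ∈ oddWord v, design v u c = 1 := by
    rw [prod_design]
    simp only [inl_mem_oddWord, inr_mem_oddWord, decide_true, grayWord_true_sum,
      ← prod_mul_distrib]
    refine prod_eq_one fun i _ => ?_
    rw [grayWord_true_mul]
    by_cases hi : v i = 1 ∨ v i = 3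
    · simp [hi]
    · simp [hi, grayWord]
  simp [this]

lemma aliasingIndex_eq_zero {R F : Type*} [Fintype R] {D : Matrix R F ℤˣ} {s : Finset F}
    (h : jChar D s = 0) : aliasingIndex D s = 0 := by
  simp [aliasingIndex, h]

lemma aliasingIndex_oddWord (v : Fin n → ZMod 4) :
    aliasingIndex (design v) (oddWord v) = 1 := by
  have : (Fintype.card (Fin n → ZMod 4) : ℚ) ≠ 0 := by exact_mod_cast Fintype.card_ne_zero
  rw [aliasingIndex, jChar_oddWord, Nat.abs_cast, Int.cast_natCast, div_self this]

lemma sum_mul_aliasingIndex_sq (v : Fin n → ZMod 4)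
    (g : Finset ((Unit ⊕ Fin n) × Fin 2) → ℚ) :
    ∑ s, g s * aliasingIndex (design v) s ^ 2 =
      g ∅ + g (oddWord v) + ∑ s ∈ mixedWords n, g s * aliasingIndex (design v) s ^ 2 := by
  have hne : (∅ : Finset ((Unit ⊕ Fin n) × Fin 2)) ≠ oddWord v :=
    (ne_empty_of_mem (inl_mem_oddWord 0)).symm
  have h1 : (∅ : Finset ((Unit ⊕ Fin n) × Fin 2)) ∉ insert (oddWord v) (mixedWords n) := by
    simp [hne, mixedWords]
  have h2 : oddWord v ∉ mixedWords n := by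
    simp [mixedWords, inl_mem_oddWord]
  rw [← sum_subset (subset_univ (insert ∅ (insert (oddWord v) (mixedWords n)))), sum_insert h1,
    sum_insert h2, aliasingIndex_oddWord, aliasingIndex_empty]
  · ring
  · intro s _ hs
    rw [aliasingIndex_eq_zero, zero_pow two_ne_zero, mul_zero]
    by_contra h
    refine hs ?_
    rw [mem_insert, mem_insert]
    exact jChar_ne_zero_cases h

/-- The runs are distinct, so Parseval gives total weight exactly 4, of which ∅ and `oddWord v` take
1 each. -/
lemma sum_mixedWords (v : Fin n → ZMod 4) :
    ∑ s ∈ mixedWords n, aliasingIndex (design v) s ^ 2 = 2 := by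
  have h1 := sum_mul_aliasingIndex_sq v fun _ => 1
  simp only [one_mul] at h1
  rw [sum_aliasingIndex_sq_of_injective (design_injective v) (four_mul_card_runs n)] at h1
  linarith

/-- The generalized wordlength pattern of `design v`. -/
lemma wordlength_design (v : Fin n → ZMod 4) {k : ℕ} (hk : 1 ≤ k) :
    wordlength (design v) k =
      (if k = 2 + 2 * (freq v 1 + freq v 3) then 1 else 0) +
        if k = 1 + (2 * freq v 2 + (freq v 1 + freq v 3)) then 2 else 0 := by
  rw [wordlength_eq_sum_ite, sum_mul_aliasingIndex_sq, card_empty, if_neg (by lia), zero_add,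
    card_oddWord]
  simp only [eq_comm (a := k)]
  congr 1
  rw [← sum_mixedWords v]
  by_cases h : 1 + (2 * freq v 2 + (freq v 1 + freq v 3)) = k
  · rw [if_pos h]
    refine sum_congr rfl fun s hs => ?_
    by_cases h0 : jChar (design v) s = 0
    · simp [aliasingIndex_eq_zero h0]
    · rw [card_of_mem_mixedWords hs h0, if_pos h, one_mul]
  · rw [if_neg h]
    refine sum_eq_zero fun s hs => ?_
    by_cases h0 : jChar (design v) s = 0
    · simp [aliasingIndex_eq_zero h0]
    · rw [card_of_mem_mixedWords hs h0, if_neg h, zero_mul]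

end Design

/-! ### Words of a half-fraction of any design -/

section HalfFraction

variable {R F : Type*} [Fintype R] [DecidableEq F]

/-- The indicator of d_{ic} = ε is (1 + ε d_{ic}) / 2. -/
lemma two_mul_jChar_halfFraction (D : Matrix R F ℤˣ) (c : F) (ε : ℤˣ) (s : Finset {j // j ≠ c}) :
    2 * jChar (halfFraction D c ε) s =
      jChar D (s.map (Function.Embedding.subtype _)) +
        ε * jChar D (insert c (s.map (Function.Embedding.subtype _))) := by
  have h1 : jChar (halfFraction D c ε) s =
      ∑ i, if D i c = ε then ∏ d ∈ s, (D i d : ℤ) else 0 := by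
    rw [← sum_filter, sum_subtype _ (p := fun i => D i c = ε) (by simp)]
    rfl
  rw [h1, jChar, jChar, mul_sum, mul_sum, ← sum_add_distrib]
  refine sum_congr rfl fun i _ => ?_
  rw [prod_insert (by simp), prod_map]
  simp only [Function.Embedding.subtype_apply]
  rcases Int.units_eq_one_or (D i c) with h | h <;> rcases Int.units_eq_one_or ε with h' | h' <;>
    simp [h, h'] <;> ring

lemma two_mul_card_halfFraction {D : Matrix R F ℤˣ} {c : F} (hc : jChar D {c} = 0) (ε : ℤˣ) :
    2 * Fintype.card {i // D i c = ε} = Fintype.card R := by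
  have := two_mul_jChar_halfFraction D c ε ∅
  rw [map_empty, insert_empty, hc] at this
  simp only [jChar, prod_empty, sum_const, card_univ, nsmul_eq_mul, mul_one, mul_zero,
    add_zero] at this
  exact_mod_cast this

variable [Fintype F]

lemma sum_finset_eq_sum_subtype {M : Type*} [AddCommMonoid M] (c : F) (f : Finset F → M) :
    ∑ t, f t = ∑ s : Finset {j // j ≠ c}, (f (s.map (Function.Embedding.subtype _)) +
      f (insert c (s.map (Function.Embedding.subtype _)))) := by
  rw [← powerset_univ, ← insert_erase (mem_univ c), sum_powerset_insert (notMem_erase _ _),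
    ← sum_add_distrib]
  symm
  refine sum_nbij' (fun s => s.map (Function.Embedding.subtype _))
    (fun t => t.subtype fun j => j ≠ c) ?_ ?_ ?_ ?_ ?_
  · intro s _
    rw [mem_powerset]
    intro d hd
    obtain ⟨e, _, rfl⟩ := mem_map.mp hd
    exact mem_erase.mpr ⟨e.2, mem_univ _⟩
  · simp
  · intro s _
    ext d
    simpa using fun _ => d.2
  · intro t ht
    rw [subtype_map, filter_true_of_mem]
    exact fun d hd => ne_of_mem_erase (mem_powerset.mp ht hd)
  · simp

/-- The generalized wordlength pattern of a half-fraction, when no word remains a word after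
deletion of the branching column. -/
lemma wordlength_halfFraction {D : Matrix R F ℤˣ} {c : F} (hc : jChar D {c} = 0)
    (h : ∀ s, c ∉ s → jChar D s * jChar D (insert c s) = 0) (ε : ℤˣ) (k : ℕ) :
    wordlength (halfFraction D c ε) k =
      ∑ s, (if s.card = if c ∈ s then k + 1 else k then 1 else 0) * aliasingIndex D s ^ 2 := by
  have hcard : (2 * Fintype.card {i // D i c = ε} : ℚ) = Fintype.card R := by
    exact_mod_cast two_mul_card_halfFraction hc ε
  rw [wordlength_eq_sum_ite, sum_finset_eq_sum_subtype c]
  refine sum_congr rfl fun s _ => ?_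
  have hcs : c ∉ s.map (Function.Embedding.subtype _) := by simp
  have h2 := congrArg (Int.cast (R := ℚ)) (two_mul_jChar_halfFraction D c ε s)
  have h3 := congrArg (Int.cast (R := ℚ)) (h _ hcs)
  have hε : ((ε : ℤ) : ℚ) ^ 2 = 1 := by
    rcases Int.units_eq_one_or ε with h | h <;> simp [h]
  rw [if_neg hcs, if_pos (mem_insert_self _ _), card_insert_of_notMem hcs, card_map,
    aliasingIndex_sq, aliasingIndex_sq, aliasingIndex_sq, ← hcard]
  simp only [add_left_inj, ← mul_add, ← add_div]
  push_cast at h2 h3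
  congr 1
  rw [mul_pow, ← div_div _ (2 ^ 2 : ℚ)]
  congr 1
  rw [eq_div_iff (by norm_num), mul_comm, ← mul_pow, h2]
  -- In the square of j(s) + ε j(s ∪ {c}) the cross term vanishes by `h3`, and ε² = 1.
  linear_combination 2 * ((ε : ℤ) : ℚ) * h3 +
    (jChar D (insert c (s.map (Function.Embedding.subtype _))) : ℚ) ^ 2 * hε

end HalfFraction

/-! ### Half-fractions of D_v -/

section DesignHalfFraction

variable {n : ℕ} {v : Fin n → ZMod 4}

lemma exists_odd_of_freq (h : 1 ≤ freq v 1 + freq v 3) : ∃ i, v i = 1 ∨ v i = 3 := by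
  by_contra! hcon
  have h1 : freq v 1 = 0 := by simp [freq, hcon]
  have h3 : freq v 3 = 0 := by simp [freq, hcon]
  lia

lemma inr_mem_iff_of_mem_mixedWords {s : Finset ((Unit ⊕ Fin n) × Fin 2)} (hs : s ∈ mixedWords n)
    (h : jChar (design v) s ≠ 0) {i : Fin n} (hi : v i = 1 ∨ v i = 3) :
    (Sum.inr i, 0) ∈ s ↔ (Sum.inr i, 1) ∉ s := by
  have hc := compatible_of_jChar_ne_zero h i
  have h02 : v i ≠ 0 ∧ v i ≠ 2 := by
    generalize v i = z at hi
    revert z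
    decide
  simp only [mixedWords, mem_filter, mem_univ, true_and] at hs
  rw [Compatible, if_neg (by simpa using hs), if_neg h02.1, if_neg h02.2] at hc
  by_cases h0 : (Sum.inr i, 0) ∈ s <;> by_cases h1 : (Sum.inr i, 1) ∈ s <;> simp_all

lemma inr_mem_of_mem_mixedWords {s : Finset ((Unit ⊕ Fin n) × Fin 2)} (hs : s ∈ mixedWords n)
    (h : jChar (design v) s ≠ 0) {i : Fin n} (hi : v i = 2) (b : Fin 2) : (Sum.inr i, b) ∈ s := by
  have hc := compatible_of_jChar_ne_zero h i
  simp only [mixedWords, mem_filter, mem_univ, true_and] at hs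
  rw [Compatible, if_neg (by simpa using hs), if_neg (by rw [hi]; decide), if_pos hi] at hc
  fin_cases b
  exacts [of_decide_eq_true hc.1, of_decide_eq_true hc.2]

/-- No two words differ by one column: mixed words have equal length, at least 2 because v has an
odd component; `oddWord v` has at least two columns; and a mixed word lacks a column from v and one
from each odd block, hence at least two columns of `oddWord v`. -/
lemma jChar_mul_jChar_insert (h : 1 ≤ freq v 1 + freq v 3) {c : (Unit ⊕ Fin n) × Fin 2}
    {s : Finset ((Unit ⊕ Fin n) × Fin 2)} (hc : c ∉ s) :
    jChar (design v) s * jChar (design v) (insert c s) = 0 := by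
  by_contra hne
  obtain ⟨h1, h2⟩ := mul_ne_zero_iff.mp hne
  have hcard := card_insert_of_notMem hc
  have hodd := card_oddWord v
  rcases jChar_ne_zero_cases h2 with e2 | e2 | e2
  · exact insert_ne_empty _ _ e2
  · rcases jChar_ne_zero_cases h1 with e1 | e1 | e1
    · rw [e2, e1, card_empty] at hcard
      lia
    · rw [e2, e1] at hcard
      lia
    · obtain ⟨i, hi⟩ := exists_odd_of_freq h
      have hi' := inr_mem_iff_of_mem_mixedWords e1 h1 hi
      have m1 (b : Fin 2) : (Sum.inr i, b) ∈ insert c s := by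
        rw [e2, inr_mem_oddWord]
        exact hi
      have m2 (b : Fin 2) : (Sum.inl (), b) ∈ insert c s := by
        rw [e2]
        exact inl_mem_oddWord b
      have hm := (mem_filter.mp e1).2
      obtain ⟨b, hb⟩ : ∃ b, (Sum.inr i, b) ∉ s := by
        by_contra! hall
        exact hi'.mp (hall 0) (hall 1)
      obtain ⟨b', hb'⟩ : ∃ b, (Sum.inl (), b) ∉ s := by
        by_contra! hall
        exact hm ⟨fun _ => hall 1, fun _ => hall 0⟩
      have q1 := (mem_insert.mp (m1 b)).resolve_right hb
      have q2 := (mem_insert.mp (m2 b')).resolve_right hb'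
      simp [← q1] at q2
  · rw [card_of_mem_mixedWords e2 h2] at hcard
    rcases jChar_ne_zero_cases h1 with e1 | e1 | e1
    · rw [e1, card_empty] at hcard
      lia
    · have hm := (mem_filter.mp e2).2
      refine hm ⟨fun _ => ?_, fun _ => ?_⟩ <;>
      · rw [e1]
        exact mem_insert_of_mem (inl_mem_oddWord _)
    · rw [card_of_mem_mixedWords e1 h1] at hcard
      lia

lemma jChar_empty {R F : Type*} [Fintype R] (D : Matrix R F ℤˣ) :
    jChar D ∅ = Fintype.card R := by
  simp [jChar]

lemma jChar_singleton (h : 1 ≤ freq v 1 + freq v 3) (c : (Unit ⊕ Fin n) × Fin 2) :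
    jChar (design v) {c} = 0 := by
  have := jChar_mul_jChar_insert h (notMem_empty c)
  rw [jChar_empty, insert_empty] at this
  refine (mul_eq_zero.mp this).resolve_left ?_
  exact_mod_cast Fintype.card_ne_zero

lemma card_runs_halfFraction (h : 1 ≤ freq v 1 + freq v 3) (c : (Unit ⊕ Fin n) × Fin 2)
    (ε : ℤˣ) : Fintype.card {u // design v u c = ε} = 2 ^ (2 * n - 1) := by
  have h1 := two_mul_card_halfFraction (jChar_singleton h c) ε
  obtain ⟨i, -⟩ := exists_odd_of_freq h
  obtain ⟨k, rfl⟩ : ∃ k, n = k + 1 := ⟨n - 1, by have := i.pos; lia⟩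
  rw [card_runs, show 2 * (k + 1) = (2 * (k + 1) - 1) + 1 by lia, pow_succ] at h1
  lia

lemma card_factors_halfFraction (c : (Unit ⊕ Fin n) × Fin 2) :
    Fintype.card {j // j ≠ c} = 2 * n + 1 := by
  rw [Fintype.card_subtype_compl, card_factors, Fintype.card_subtype_eq]
  rfl

/-- The generalized wordlength pattern of a half-fraction of `design v`; here `X` is the total
weight of the mixed words through the branching column. -/
lemma wordlength_halfFraction_design (h : 1 ≤ freq v 1 + freq v 3)
    {c : (Unit ⊕ Fin n) × Fin 2} {X : ℚ}
    (hX : ∑ s ∈ mixedWords n, (if c ∈ s then 1 else 0) * aliasingIndex (design v) s ^ 2 = X)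
    (ε : ℤˣ) {k : ℕ} (hk : 1 ≤ k) :
    wordlength (halfFraction (design v) c ε) k =
      (if 2 + 2 * (freq v 1 + freq v 3) = if c ∈ oddWord v then k + 1 else k then 1 else 0) +
      ((if 1 + (2 * freq v 2 + (freq v 1 + freq v 3)) = k + 1 then X else 0) +
        if 1 + (2 * freq v 2 + (freq v 1 + freq v 3)) = k then 2 - X else 0) := by
  rw [wordlength_halfFraction (jChar_singleton h c) (fun s => jChar_mul_jChar_insert h) ε k,
    sum_mul_aliasingIndex_sq, card_empty, if_neg (notMem_empty c), if_neg (by lia), zero_add,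
    card_oddWord]
  congr 1
  set L := 1 + (2 * freq v 2 + (freq v 1 + freq v 3)) with hL
  have hX' : ∑ s ∈ mixedWords n, (if c ∈ s then 0 else 1) * aliasingIndex (design v) s ^ 2 =
      2 - X := by
    rw [← sum_mixedWords v, ← hX, ← sum_sub_distrib]
    refine sum_congr rfl fun s _ => ?_
    split_ifs <;> ring
  have : ∀ s ∈ mixedWords n, (if s.card = if c ∈ s then k + 1 else k then (1 : ℚ) else 0) *
      aliasingIndex (design v) s ^ 2 =
      (if L = k + 1 then 1 else 0) * ((if c ∈ s then 1 else 0) * aliasingIndex (design v) s ^ 2) +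
      (if L = k then 1 else 0) * ((if c ∈ s then 0 else 1) * aliasingIndex (design v) s ^ 2) := by
    intro s hs
    by_cases h0 : jChar (design v) s = 0
    · simp [aliasingIndex_eq_zero h0]
    · rw [card_of_mem_mixedWords hs h0, ← hL]
      by_cases hcs : c ∈ s <;> simp [hcs]
  rw [sum_congr rfl this, sum_add_distrib, ← mul_sum, ← mul_sum, hX, hX']
  simp

/-- Interchange of the two Gray columns of each quaternary column. -/
def swapColumns (n : ℕ) : (Unit ⊕ Fin n) × Fin 2 ≃ (Unit ⊕ Fin n) × Fin 2 :=
  Equiv.prodCongr (Equiv.refl _) Fin.revPerm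

lemma design_neg (u : Fin n → ZMod 4) (c : (Unit ⊕ Fin n) × Fin 2) :
    design v (-u) c = design v u (swapColumns n c) := by
  rw [design, binaryImage, neg_vecMul, Pi.neg_apply, gray_neg]
  rfl

lemma jChar_map_swapColumns (s : Finset ((Unit ⊕ Fin n) × Fin 2)) :
    jChar (design v) (s.map (swapColumns n).toEmbedding) = jChar (design v) s := by
  rw [jChar, jChar, ← Equiv.sum_comp (Equiv.neg _) fun u => ∏ c ∈ s, (design v u c : ℤ)]
  refine sum_congr rfl fun u _ => ?_
  rw [prod_map]
  refine prod_congr rfl fun c _ => ?_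
  rw [Equiv.neg_apply, design_neg]
  rfl

lemma map_swapColumns_mem_mixedWords {s : Finset ((Unit ⊕ Fin n) × Fin 2)}
    (hs : s ∈ mixedWords n) : s.map (swapColumns n).toEmbedding ∈ mixedWords n := by
  simp only [mixedWords, mem_filter, mem_univ, true_and] at hs ⊢
  rw [mem_map_equiv, mem_map_equiv]
  exact fun h => hs h.symm

lemma swapColumns_swapColumns (c : (Unit ⊕ Fin n) × Fin 2) :
    swapColumns n (swapColumns n c) = c := by
  exact Prod.ext rfl (Fin.rev_rev c.2)

lemma map_swapColumns_map_swapColumns (s : Finset ((Unit ⊕ Fin n) × Fin 2)) :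
    (s.map (swapColumns n).toEmbedding).map (swapColumns n).toEmbedding = s := by
  ext c
  rw [mem_map_equiv, mem_map_equiv, show (swapColumns n).symm = swapColumns n from rfl,
    swapColumns_swapColumns]

/-- The substitution u ↦ -u permutes the runs and interchanges the Gray columns, so it preserves
weights. -/
lemma sum_mixedWords_swapColumns (c : (Unit ⊕ Fin n) × Fin 2) :
    ∑ s ∈ mixedWords n, (if swapColumns n c ∈ s then 1 else 0) * aliasingIndex (design v) s ^ 2 =
      ∑ s ∈ mixedWords n, (if c ∈ s then 1 else 0) * aliasingIndex (design v) s ^ 2 := by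
  refine sum_nbij' (fun s => s.map (swapColumns n).toEmbedding)
    (fun s => s.map (swapColumns n).toEmbedding) (fun s => map_swapColumns_mem_mixedWords)
    (fun s => map_swapColumns_mem_mixedWords) (fun s _ => map_swapColumns_map_swapColumns s)
    (fun s _ => map_swapColumns_map_swapColumns s) fun s _ => ?_
  rw [aliasingIndex_sq, aliasingIndex_sq, jChar_map_swapColumns]
  congr 2
  rw [mem_map_equiv]
  rfl

/-- Each mixed word of nonzero weight contains exactly one of `c` and its swap, and the symmetry
divides the total weight 2 equally between them. -/
lemma sum_mixedWords_of_odd_or_inl {c : (Unit ⊕ Fin n) × Fin 2}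
    (hc : AssociatedWithNumber v 1 c ∨ AssociatedWithNumber v 3 c ∨ AssociatedWithVector c) :
    ∑ s ∈ mixedWords n, (if c ∈ s then 1 else 0) * aliasingIndex (design v) s ^ 2 = 1 := by
  have key : ∀ s ∈ mixedWords n, jChar (design v) s ≠ 0 → (c ∈ s ↔ swapColumns n c ∉ s) := by
    intro s hs h
    obtain ⟨p, b⟩ := c
    have hp : (p, (0 : Fin 2)) ∈ s ↔ (p, 1) ∉ s := by
      rcases hc with ⟨i, hp, hi⟩ | ⟨i, hp, hi⟩ | hp
      · obtain rfl : p = _ := hp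
        exact inr_mem_iff_of_mem_mixedWords hs h (Or.inl hi)
      · obtain rfl : p = _ := hp
        exact inr_mem_iff_of_mem_mixedWords hs h (Or.inr hi)
      · obtain rfl : p = _ := hp
        have hm := (mem_filter.mp hs).2
        tauto
    fin_cases b
    · exact hp
    · change (p, (1 : Fin 2)) ∈ s ↔ (p, 0) ∉ s
      tauto
  have h2 := sum_mixedWords v
  have h3 := sum_mixedWords_swapColumns (v := v) c
  have h4 : ∑ s ∈ mixedWords n, aliasingIndex (design v) s ^ 2 =
      ∑ s ∈ mixedWords n, (if c ∈ s then 1 else 0) * aliasingIndex (design v) s ^ 2 +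
      ∑ s ∈ mixedWords n,
        (if swapColumns n c ∈ s then 1 else 0) * aliasingIndex (design v) s ^ 2 := by
    rw [← sum_add_distrib]
    refine sum_congr rfl fun s hs => ?_
    by_cases h0 : jChar (design v) s = 0
    · simp [aliasingIndex_eq_zero h0]
    · have := key s hs h0
      by_cases hcs : swapColumns n c ∈ s <;> simp [hcs, this]
  linarith

lemma sum_mixedWords_of_two {c : (Unit ⊕ Fin n) × Fin 2} (hc : AssociatedWithNumber v 2 c) :
    ∑ s ∈ mixedWords n, (if c ∈ s then 1 else 0) * aliasingIndex (design v) s ^ 2 = 2 := by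
  rw [← sum_mixedWords v]
  refine sum_congr rfl fun s hs => ?_
  by_cases h0 : jChar (design v) s = 0
  · simp [aliasingIndex_eq_zero h0]
  · obtain ⟨p, b⟩ := c
    obtain ⟨i, hp, hi⟩ := hc
    obtain rfl : p = _ := hp
    rw [if_pos (inr_mem_of_mem_mixedWords hs h0 hi b), one_mul]

lemma notMem_oddWord_of_two {c : (Unit ⊕ Fin n) × Fin 2} (hc : AssociatedWithNumber v 2 c) :
    c ∉ oddWord v := by
  obtain ⟨p, b⟩ := c
  obtain ⟨i, hp, hi⟩ := hc
  obtain rfl : p = _ := hp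
  rw [inr_mem_oddWord, hi]
  decide

lemma mem_oddWord_of_odd_or_inl {c : (Unit ⊕ Fin n) × Fin 2}
    (hc : AssociatedWithNumber v 1 c ∨ AssociatedWithNumber v 3 c ∨ AssociatedWithVector c) :
    c ∈ oddWord v := by
  obtain ⟨p, b⟩ := c
  rcases hc with ⟨i, hp, hi⟩ | ⟨i, hp, hi⟩ | hp
  · obtain rfl : p = _ := hp
    exact (inr_mem_oddWord i b).mpr (Or.inl hi)
  · obtain rfl : p = _ := hp
    exact (inr_mem_oddWord i b).mpr (Or.inr hi)
  · obtain rfl : p = _ := hp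
    exact inl_mem_oddWord b

end DesignHalfFraction

/-! ### Projectivity of D_v -/

section DesignProjectivity

variable {n : ℕ} {v : Fin n → ZMod 4}

/-- Cyclic neighbours in Z_4 differ in one Gray bit, so one free bit allows a component to move by
some odd d. -/
lemma exists_shift_gray (x : ZMod 4) (b : Fin 2) :
    ∃ d : ZMod 4, (d = 1 ∨ d = 3) ∧ ∀ b', b' ≠ b → gray (x + d) b' = gray x b' := by
  revert x b
  decide

set_option synthInstance.maxSize 1000 in
lemma exists_mul_add_ite_eq (w a r : ZMod 4) (hw : w ≠ 0) (ha : a ≠ 0) (h : w ≠ 2 ∨ a ≠ 2) :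
    ∃ e : Bool, ∃ t, w * t + (if e then a else 0) = r := by
  revert w a r
  decide

/-- At least two of the coefficients are odd; the subset sums of two odd elements and a third
nonzero one cover Z_4. -/
lemma exists_add_ite_eq (a b c r : ZMod 4) (ha : a ≠ 0) (hb : b ≠ 0) (hc : c ≠ 0)
    (hab : a ≠ 2 ∨ b ≠ 2) (hac : a ≠ 2 ∨ c ≠ 2) (hbc : b ≠ 2 ∨ c ≠ 2) :
    ∃ e₁ e₂ e₃ : Bool,
      (if e₁ then a else 0) + (if e₂ then b else 0) + (if e₃ then c else 0) = r := by
  revert a b c r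
  decide

lemma mul_odd_ne {w d z : ZMod 4} (hd : d = 1 ∨ d = 3) (hz : z = 0 ∨ z = 2) (hw : w ≠ z) :
    w * d ≠ z := by
  revert w d z
  decide

/-- Three factors, two to each quaternary column, either include both factors of some quaternary
column or come from three different ones. -/
lemma exists_pair_or_triple {κ : Type*} [DecidableEq κ] {T : Finset (κ × Fin 2)}
    (hT : T.card = 3) :
    (∃ p q b, q ≠ p ∧ (∀ b', (p, b') ∈ T) ∧ (q, b) ∈ T) ∨
    ∃ p q r b₁ b₂ b₃, p ≠ q ∧ p ≠ r ∧ q ≠ r ∧ (p, b₁) ∈ T ∧ (q, b₂) ∈ T ∧ (r, b₃) ∈ T := by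
  obtain ⟨⟨p, b₁⟩, ⟨q, b₂⟩, ⟨r, b₃⟩, hpq, hpr, hqr, rfl⟩ := card_eq_three.mp hT
  have full {b b' : Fin 2} (h : b ≠ b') (x : Fin 2) : x = b ∨ x = b' := by
    revert x b b'
    decide
  have other {p : κ} {b b' b'' : Fin 2} (h1 : (p, b) ≠ (p, b')) (h2 : (p, b) ≠ (p, b''))
      (h3 : (p, b') ≠ (p, b'')) : False := by
    simp only [ne_eq, Prod.mk.injEq, true_and] at h1 h2 h3
    lia
  by_cases h1 : p = q
  · subst h1
    left
    refine ⟨p, r, b₃, ?_, fun b' => ?_, by simp⟩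
    · rintro rfl
      exact other hpq hpr hqr
    · rcases full (b := b₁) (b' := b₂) (by simpa using hpq) b' with rfl | rfl <;> simp
  by_cases h2 : p = r
  · subst h2
    left
    refine ⟨p, q, b₂, Ne.symm h1, fun b' => ?_, by simp⟩
    rcases full (b := b₁) (b' := b₃) (by simpa using hpr) b' with rfl | rfl <;> simp
  by_cases h3 : q = r
  · subst h3
    left
    refine ⟨q, p, b₁, h1, fun b' => ?_, by simp⟩
    rcases full (b := b₂) (b' := b₃) (by simpa using hqr) b' with rfl | rfl <;> simp
  · right
    exact ⟨p, q, r, b₁, b₂, b₃, h1, h2, h3, by simp, by simp, by simp⟩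

/-- A single parity check over `ZMod 4` can be satisfied with all but three of the Gray bits
prescribed, if its coefficients are nonzero and at most one of them is equal to `2`. -/
lemma exists_gray_eq_and_sum_eq_zero {κ : Type*} [Fintype κ] [DecidableEq κ] {w : κ → ZMod 4}
    (h0 : ∀ p, w p ≠ 0) (h2 : ∀ p q, p ≠ q → w p ≠ 2 ∨ w q ≠ 2)
    {T : Finset (κ × Fin 2)} (hT : T.card = 3) (x : κ × Fin 2 → ℤˣ) :
    ∃ y : κ → ZMod 4, (∀ c, c ∉ T → gray (y c.1) c.2 = x c) ∧ ∑ p, w p * y p = 0 := by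
  choose y₀ hy₀ using fun p => exists_gray_eq fun b => x (p, b)
  have hy (p b) : gray (y₀ p) b = x (p, b) := congrFun (hy₀ p) b
  rcases exists_pair_or_triple hT with
    ⟨p, q, b, hqp, hp, hq⟩ | ⟨p, q, r, b₁, b₂, b₃, hpq, hpr, hqr, hp, hq, hr⟩
  -- Both bits of `p` are free, so its component may move by any `t`; the free bit of `q` supplies
  -- the other parity when `w p = 2`.
  · obtain ⟨d, hd, hdb⟩ := exists_shift_gray (y₀ q) b
    obtain ⟨e, t, hte⟩ := exists_mul_add_ite_eq (w p) (w q * d) (-∑ p, w p * y₀ p) (h0 p)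
      (mul_odd_ne hd (Or.inl rfl) (h0 q))
      ((h2 p q hqp.symm).imp_right fun h => mul_odd_ne hd (Or.inr rfl) h)
    refine ⟨y₀ + Pi.single p t + Pi.single q (if e then d else 0), ?_, ?_⟩
    · rintro ⟨c, b'⟩ hc
      by_cases hcp : c = p
      · exact absurd (hcp ▸ hp b') hc
      by_cases hcq : c = q
      · subst hcq
        have hb : b' ≠ b := fun h => hc (h ▸ hq)
        cases e <;> simp [hcp, hy, hdb b' hb]
      · simp [hcp, hcq, hy]
    · simp only [Pi.add_apply, mul_add, sum_add_distrib, Pi.single_apply, mul_ite, mul_zero,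
        sum_ite_eq', mem_univ, if_true]
      rw [add_assoc, hte, add_neg_cancel]
  -- Each of the three components may stay or move by its own odd shift.
  · obtain ⟨d₁, hd₁, hb₁⟩ := exists_shift_gray (y₀ p) b₁
    obtain ⟨d₂, hd₂, hb₂⟩ := exists_shift_gray (y₀ q) b₂
    obtain ⟨d₃, hd₃, hb₃⟩ := exists_shift_gray (y₀ r) b₃
    have hd {a a' d d' : ZMod 4} (hd : d = 1 ∨ d = 3) (hd' : d' = 1 ∨ d' = 3)
        (h : a ≠ 2 ∨ a' ≠ 2) : a * d ≠ 2 ∨ a' * d' ≠ 2 :=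
      h.imp (mul_odd_ne hd (Or.inr rfl)) (mul_odd_ne hd' (Or.inr rfl))
    obtain ⟨e₁, e₂, e₃, he⟩ := exists_add_ite_eq (w p * d₁) (w q * d₂) (w r * d₃)
      (-∑ p, w p * y₀ p) (mul_odd_ne hd₁ (Or.inl rfl) (h0 p))
      (mul_odd_ne hd₂ (Or.inl rfl) (h0 q)) (mul_odd_ne hd₃ (Or.inl rfl) (h0 r))
      (hd hd₁ hd₂ (h2 p q hpq)) (hd hd₁ hd₃ (h2 p r hpr)) (hd hd₂ hd₃ (h2 q r hqr))
    refine ⟨y₀ + Pi.single p (if e₁ then d₁ else 0) + Pi.single q (if e₂ then d₂ else 0) +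
      Pi.single r (if e₃ then d₃ else 0), ?_, ?_⟩
    · rintro ⟨c, b'⟩ hc
      by_cases hcp : c = p
      · subst hcp
        have hb : b' ≠ b₁ := fun h => hc (h ▸ hp)
        cases e₁ <;> simp [hpq, hpr, hy, hb₁ b' hb]
      by_cases hcq : c = q
      · subst hcq
        have hb : b' ≠ b₂ := fun h => hc (h ▸ hq)
        cases e₂ <;> simp [hcp, hqr, hy, hb₂ b' hb]
      by_cases hcr : c = r
      · subst hcr
        have hb : b' ≠ b₃ := fun h => hc (h ▸ hr)
        cases e₃ <;> simp [hcp, hcq, hy, hb₃ b' hb]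
      · simp [hcp, hcq, hcr, hy]
    · simp only [Pi.add_apply, mul_add, sum_add_distrib, Pi.single_apply, mul_ite, mul_zero,
        sum_ite_eq', mem_univ, if_true]
      rw [add_assoc, add_assoc, ← add_assoc (if e₁ then w p * d₁ else 0), he, add_neg_cancel]

lemma projectsOntoFactorials_design (h0 : ∀ i, v i ≠ 0)
    (h2 : ∀ i j, i ≠ j → v i ≠ 2 ∨ v j ≠ 2) :
    ProjectsOntoFactorials (design v) (2 * n - 1) := by
  intro s hs x
  rcases Nat.eq_zero_or_pos n with rfl | hn
  -- For n = 0 the subtraction truncates to 0 and the complement has two columns instead of three.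
  · exact ⟨0, fun c hc => absurd hs (card_ne_zero_of_mem hc)⟩
  have neg_one_ne : (-1 : ZMod 4) ≠ 0 := by decide
  have neg_one_ne_two : (-1 : ZMod 4) ≠ 2 := by decide
  have hT : sᶜ.card = 3 := by
    rw [card_compl, card_factors, hs]
    lia
  obtain ⟨y, hy, hsum⟩ := exists_gray_eq_and_sum_eq_zero
    (w := Sum.elim (fun _ : Unit => (-1 : ZMod 4)) v) (T := sᶜ)
    (by
      rintro (_ | i)
      exacts [neg_one_ne, h0 i])
    (by
      rintro (a | i) (b | j) hij
      · exact absurd rfl hij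
      · exact Or.inl neg_one_ne_two
      · exact Or.inr neg_one_ne_two
      · exact h2 i j fun h => hij (h ▸ rfl)) hT x
  have hl : ∑ i, y (Sum.inr i) * v i = y (Sum.inl ()) := by
    simp only [Fintype.sum_sum_type, univ_unique, sum_singleton, Sum.elim_inl, Sum.elim_inr] at hsum
    simp only [mul_comm (y _)]
    have : (default : Unit) = () := rfl
    linear_combination hsum
  refine ⟨fun i => y (Sum.inr i), fun c hc => ?_⟩
  rw [← hy c (by simpa using hc)]
  obtain ⟨p | i, b⟩ := c
  · rw [design_inl, hl]
  · rw [design_inr]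

lemma sum_freq (v : Fin n → ZMod 4) : freq v 0 + freq v 1 + freq v 2 + freq v 3 = n := by
  simp only [freq_eq_sum, ← sum_add_distrib]
  have (i : Fin n) : ((((if v i = 0 then 1 else 0) + if v i = 1 then 1 else 0) +
      if v i = 2 then 1 else 0) + if v i = 3 then 1 else 0) = 1 := by
    generalize v i = z
    revert z
    decide
  simp [this]

lemma projectsOntoFactorials_design_of_freq
    (h : (freq v 1 + freq v 3 + 1 = n ∧ freq v 2 = 1) ∨
      (freq v 1 + freq v 3 = n ∧ freq v 2 = 0)) :
    ProjectsOntoFactorials (design v) (2 * n - 1) := by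
  have hs := sum_freq v
  refine projectsOntoFactorials_design (fun i hi => ?_) fun i j hij => ?_
  · have h0 : freq v 0 = 0 := by lia
    have := filter_eq_empty_iff.mp (card_eq_zero.mp h0) (mem_univ i)
    exact this hi
  · by_contra! hcon
    have h2 : freq v 2 ≤ 1 := by lia
    exact hij (card_le_one.mp h2 i (by simp [hcon.1]) j (by simp [hcon.2]))

end DesignProjectivity

/-! ### The aberration criterion for D_v and its half-fractions -/

section MinimumAberration

variable {n : ℕ}

lemma hasMinimumAberration_design (v : Fin n → ZMod 4) {r a : ℕ} (hr : 1 ≤ r)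
    (hrn : n + 1 ≤ r) (ha : 3 * r + 3 = 2 * (2 * n + 2) + a)
    (hw : ∀ i, 1 ≤ i → wordlength (design v) i =
      if i = r then (a : ℚ) else if i = r + 1 then 3 - a else 0) :
    HasMinimumAberration (2 ^ (2 * n)) (2 * n + 2) (design v) :=
  hasMinimumAberration_of_wordlength (card_runs n) (card_factors n) (by ring) hr (by lia) ha hw

lemma hasMinimumAberration_halfFraction {v : Fin n → ZMod 4} (h : 1 ≤ freq v 1 + freq v 3)
    (c : (Unit ⊕ Fin n) × Fin 2) (ε : ℤˣ) {r a : ℕ} (hr : 1 ≤ r)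
    (hrn : n + 1 ≤ r) (ha : 3 * r + 3 = 2 * (2 * n + 1) + a)
    (hw : ∀ i, 1 ≤ i → wordlength (halfFraction (design v) c ε) i =
      if i = r then (a : ℚ) else if i = r + 1 then 3 - a else 0) :
    HasMinimumAberration (2 ^ (2 * n - 1)) (2 * n + 1) (halfFraction (design v) c ε) := by
  refine hasMinimumAberration_of_wordlength (card_runs_halfFraction h c ε)
    (card_factors_halfFraction c) ?_ hr (by lia) ha hw
  have := sum_freq v
  rw [show 2 * n + 1 = 2 * n - 1 + 2 by lia, pow_add]
  ring

end MinimumAberration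

end QuaternaryDesign

theorem theorem10 :
    -- (a), designs with `2^(2n)` runs and `2n + 2` factors
    (∀ (n k : ℕ) (v : Fin n → ZMod 4), 1 ≤ k → n + 1 = 3 * k →
      freq v 1 + freq v 3 + 1 = 2 * k → freq v 2 = k →
        HasMinimumAberration (2 ^ (2 * n)) (2 * n + 2) (design v) ∧
        ∀ i, 1 ≤ i → wordlength (design v) i = if i = 4 * k then 3 else 0) ∧
    (∀ (n k : ℕ) (v : Fin n → ZMod 4), 1 ≤ k → n = 3 * k →
      freq v 1 + freq v 3 = 2 * k → freq v 2 = k →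
        HasMinimumAberration (2 ^ (2 * n)) (2 * n + 2) (design v) ∧
        ∀ i, 1 ≤ i → wordlength (design v) i =
          if i = 4 * k + 1 then 2 else if i = 4 * k + 2 then 1 else 0) ∧
    (∀ (n k : ℕ) (v : Fin n → ZMod 4), 1 ≤ k → n = 3 * k + 1 →
      freq v 1 + freq v 3 = 2 * k → freq v 2 = k + 1 →
        HasMinimumAberration (2 ^ (2 * n)) (2 * n + 2) (design v) ∧
        ∀ i, 1 ≤ i → wordlength (design v) i =
          if i = 4 * k + 2 then 1 else if i = 4 * k + 3 then 2 else 0) ∧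
    -- (a), half-fractions with `2^(2n-1)` runs and `2n + 1` factors
    (∀ (n k : ℕ) (v : Fin n → ZMod 4), 1 ≤ k → n + 1 = 3 * k →
      freq v 1 + freq v 3 + 1 = 2 * k → freq v 2 = k →
      ∀ (c : (Unit ⊕ Fin n) × Fin 2) (ε : ℤˣ), AssociatedWithNumber v 2 c →
        HasMinimumAberration (2 ^ (2 * n - 1)) (2 * n + 1) (halfFraction (design v) c ε) ∧
        ∀ i, 1 ≤ i → wordlength (halfFraction (design v) c ε) i =
          if i + 1 = 4 * k then 2 else if i = 4 * k then 1 else 0) ∧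
    (∀ (n k : ℕ) (v : Fin n → ZMod 4), 1 ≤ k → n = 3 * k →
      freq v 1 + freq v 3 = 2 * k → freq v 2 = k →
      ∀ (c : (Unit ⊕ Fin n) × Fin 2) (ε : ℤˣ),
        (AssociatedWithNumber v 1 c ∨ AssociatedWithNumber v 3 c ∨ AssociatedWithVector c) →
        HasMinimumAberration (2 ^ (2 * n - 1)) (2 * n + 1) (halfFraction (design v) c ε) ∧
        ∀ i, 1 ≤ i → wordlength (halfFraction (design v) c ε) i =
          if i = 4 * k then 1 else if i = 4 * k + 1 then 2 else 0) ∧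
    (∀ (n k : ℕ) (v : Fin n → ZMod 4), 1 ≤ k → n = 3 * k + 1 →
      freq v 1 + freq v 3 = 2 * k → freq v 2 = k + 1 →
      ∀ (c : (Unit ⊕ Fin n) × Fin 2) (ε : ℤˣ), AssociatedWithNumber v 2 c →
        HasMinimumAberration (2 ^ (2 * n - 1)) (2 * n + 1) (halfFraction (design v) c ε) ∧
        ∀ i, 1 ≤ i → wordlength (halfFraction (design v) c ε) i =
          if i = 4 * k + 2 then 3 else 0) ∧
    -- (b), designs with `2^(2n)` runs and `m = 2n + 2` factors: projectivity `m - 3 = 2n - 1`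
    (∀ (n : ℕ) (v : Fin n → ZMod 4), 1 ≤ n →
      ((freq v 1 + freq v 3 + 1 = n ∧ freq v 2 = 1) ∨
        (freq v 1 + freq v 3 = n ∧ freq v 2 = 0)) →
        HasMaximumProjectivity (2 ^ (2 * n)) (2 * n + 2) (2 * n - 1) (design v)) ∧
    -- (b), half-fractions with `m = 2n + 1` factors: projectivity `m - 3 = 2n - 2`
    (∀ (n : ℕ) (v : Fin n → ZMod 4), 2 ≤ n →
      ((freq v 1 + freq v 3 + 1 = n ∧ freq v 2 = 1) ∨
        (freq v 1 + freq v 3 = n ∧ freq v 2 = 0)) →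
      ∀ (c : (Unit ⊕ Fin n) × Fin 2) (ε : ℤˣ),
        HasMaximumProjectivity (2 ^ (2 * n - 1)) (2 * n + 1) (2 * n - 2)
          (halfFraction (design v) c ε)) := by
  refine ⟨fun n k v hk hn h13 h2 => ?_, fun n k v hk hn h13 h2 => ?_,
    fun n k v hk hn h13 h2 => ?_, fun n k v hk hn h13 h2 c ε hc => ?_,
    fun n k v hk hn h13 h2 c ε hc => ?_, fun n k v hk hn h13 h2 c ε hc => ?_,
    fun n v hn h => ?_, fun n v hn h c ε => ?_⟩
  · have hw (i : ℕ) (hi : 1 ≤ i) : wordlength (design v) i = if i = 4 * k then 3 else 0 := by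
      rw [wordlength_design v hi]
      by_cases h : i = 4 * k
      · rw [if_pos h, if_pos (by lia), if_pos (by lia)]
        norm_num
      · rw [if_neg h, if_neg (by lia), if_neg (by lia), add_zero]
    refine ⟨hasMinimumAberration_design v (r := 4 * k) (a := 3) (by lia) (by lia) (by lia)
      fun i hi => ?_, hw⟩
    rw [hw i hi]
    split_ifs <;> norm_num
  · have hw (i : ℕ) (hi : 1 ≤ i) : wordlength (design v) i =
        if i = 4 * k + 1 then 2 else if i = 4 * k + 2 then 1 else 0 := by
      rw [wordlength_design v hi]
      by_cases h : i = 4 * k + 1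
      · rw [if_pos h, if_neg (by lia), if_pos (by lia), zero_add]
      by_cases h' : i = 4 * k + 2
      · rw [if_neg h, if_pos h', if_pos (by lia), if_neg (by lia), add_zero]
      · rw [if_neg h, if_neg h', if_neg (by lia), if_neg (by lia), add_zero]
    refine ⟨hasMinimumAberration_design v (r := 4 * k + 1) (a := 2) (by lia) (by lia) (by lia)
      fun i hi => ?_, hw⟩
    rw [hw i hi]
    norm_num
  · have hw (i : ℕ) (hi : 1 ≤ i) : wordlength (design v) i =
        if i = 4 * k + 2 then 1 else if i = 4 * k + 3 then 2 else 0 := by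
      rw [wordlength_design v hi]
      by_cases h : i = 4 * k + 2
      · rw [if_pos h, if_pos (by lia), if_neg (by lia), add_zero]
      by_cases h' : i = 4 * k + 3
      · rw [if_neg h, if_pos h', if_neg (by lia), if_pos (by lia), zero_add]
      · rw [if_neg h, if_neg h', if_neg (by lia), if_neg (by lia), add_zero]
    refine ⟨hasMinimumAberration_design v (r := 4 * k + 2) (a := 1) (by lia) (by lia) (by lia)
      fun i hi => ?_, hw⟩
    rw [hw i hi]
    norm_num
  · have hodd : 1 ≤ freq v 1 + freq v 3 := by lia
    have hw (i : ℕ) (hi : 1 ≤ i) : wordlength (halfFraction (design v) c ε) i =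
        if i + 1 = 4 * k then 2 else if i = 4 * k then 1 else 0 := by
      -- All words have length 4k in D_v; the mixed ones, of weight 2, pass through `c` and drop to
      -- 4k - 1, while `oddWord v` avoids `c`.
      rw [wordlength_halfFraction_design hodd (sum_mixedWords_of_two hc) ε hi,
        if_neg (notMem_oddWord_of_two hc), sub_self, ite_self, add_zero]
      by_cases h : i + 1 = 4 * k
      · rw [if_pos h, if_neg (by lia), if_pos (by lia), zero_add]
      by_cases h' : i = 4 * k
      · rw [if_neg h, if_pos h', if_pos (by lia), if_neg (by lia), add_zero]
      · rw [if_neg h, if_neg h', if_neg (by lia), if_neg (by lia), add_zero]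
    refine ⟨hasMinimumAberration_halfFraction hodd c ε (r := 4 * k - 1) (a := 2) (by lia) (by lia)
      (by lia) fun i hi => ?_, hw⟩
    rw [hw i hi]
    have e1 : i = 4 * k - 1 ↔ i + 1 = 4 * k := by lia
    have e2 : i = 4 * k - 1 + 1 ↔ i = 4 * k := by lia
    simp only [e1, e2]
    norm_num
  · have hodd : 1 ≤ freq v 1 + freq v 3 := by lia
    have hw (i : ℕ) (hi : 1 ≤ i) : wordlength (halfFraction (design v) c ε) i =
        if i = 4 * k then 1 else if i = 4 * k + 1 then 2 else 0 := by
      -- `oddWord v` drops from 4k + 2 to 4k + 1; of the mixed weight at 4k + 1, one half drops to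
      -- 4k and the other stays.
      rw [wordlength_halfFraction_design hodd (sum_mixedWords_of_odd_or_inl hc) ε hi,
        if_pos (mem_oddWord_of_odd_or_inl hc)]
      by_cases h : i = 4 * k
      · rw [if_pos h, if_neg (by lia), if_pos (by lia), if_neg (by lia), add_zero, zero_add]
      by_cases h' : i = 4 * k + 1
      · rw [if_neg h, if_pos h', if_pos (by lia), if_neg (by lia), if_pos (by lia)]
        norm_num
      · rw [if_neg h, if_neg h', if_neg (by lia), if_neg (by lia), if_neg (by lia), add_zero,
          add_zero]
    refine ⟨hasMinimumAberration_halfFraction hodd c ε (r := 4 * k) (a := 1) (by lia) (by lia)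
      (by lia) fun i hi => ?_, hw⟩
    rw [hw i hi]
    norm_num
  · have hw (i : ℕ) (hi : 1 ≤ i) : wordlength (halfFraction (design v) c ε) i =
        if i = 4 * k + 2 then 3 else 0 := by
      -- The mixed words drop from 4k + 3 to 4k + 2, the length that `oddWord v` keeps.
      rw [wordlength_halfFraction_design (by lia) (sum_mixedWords_of_two hc) ε hi,
        if_neg (notMem_oddWord_of_two hc), sub_self, ite_self, add_zero]
      by_cases h : i = 4 * k + 2
      · rw [if_pos h, if_pos (by lia), if_pos (by lia)]
        norm_num
      · rw [if_neg h, if_neg (by lia), if_neg (by lia), add_zero]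
    refine ⟨hasMinimumAberration_halfFraction (by lia) c ε (r := 4 * k + 2) (a := 3) (by lia)
      (by lia) (by lia) fun i hi => ?_, hw⟩
    rw [hw i hi]
    split_ifs <;> norm_num
  · exact hasMaximumProjectivity_of_projectsOntoFactorials (card_runs n) (card_factors n)
      (by congr 1; lia) (by lia) (by lia) (projectsOntoFactorials_design_of_freq h)
  · refine hasMaximumProjectivity_of_projectsOntoFactorials
      (card_runs_halfFraction (by lia) c ε) (card_factors_halfFraction c)
      (by congr 1; lia) (by lia) (by lia) (ProjectsOntoFactorials.halfFraction ?_ c ε)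
    rw [show 2 * n - 2 + 1 = 2 * n - 1 by lia]
    exact projectsOntoFactorials_design_of_freq h
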